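/- In the Mermin--GHZ game, Alice, Bob and Charlie receive bits $x^{(A)},x^{(B)},x^{(C)}$ with $x^{(A)}+x^{(B)}+x^{(C)}\equiv 0 \pmod 2$ and, without communicating, must output bits $y^{(A)},y^{(B)},y^{(C)}$ with $$y^{(A)}\oplus y^{(B)}\oplus y^{(C)}=\frac{x^{(A)}+x^{(B)}+x^{(C)}}{2}.$$ The Mermin--GHZ correlations are the probabilities $\Pr(y^{(A)},y^{(B)},y^{(C)}\mid x^{(A)},x^{(B)},x^{(C)})$, for these inputs, that arise when the participants share the state $\frac{1}{\sqrt2}(|000\rangle+|111\rangle)$ and each measures the Pauli observable $X$ on input $0$ and $Y$ on input $1$, outputting $y$ for the eigenvalue $(-1)^y$. A strategy simulates these correlations if it wins the game with probability one on every admissible input and its output probabilities on every admissible input equal the Mermin--GHZ correlations. A non-local box (NLB) is a device with two ends that, on input bits $a$ and $b$, returns bits $z$ and $w$ at the respective ends, uniformly distributed over the solutions of $z\oplus w=a\wedge b$. Then the following hold. 1. The quantum strategy on the state $\frac{1}{\sqrt2}(|000\rangle+|111\rangle)$ described above wins the Mermin--GHZ game with probability one. 2. There is a classical protocol without communication, using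 shared randomness and a single use of one NLB shared by Alice and Bob, that simulates the Mermin--GHZ correlations. 3. Suppose that two of the participants (any two) share a qubit pair in a state $\alpha|00\rangle+\beta|11\rangle$ with $\alpha,\beta\in\mathbb{C}$, $|\alpha|^2+|\beta|^2=1$, and that there is no further entanglement. Then no strategy without communication, in which the participants use shared randomness and local quantum measurements (POVMs), wins the Mermin--GHZ game with probability one; in particular none simulates the Mermin--GHZ correlations. 4. The same holds if each two of the three participants share such a qubit pair $\alpha_k|00\rangle+\beta_k|11\rangle$, $k=1,2,3$ (one pair for each two participants, with possibly different coefficients), and there is no further entanglement. -/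

import Mathlib

open MeasureTheory
open scoped ComplexOrder

noncomputable section

/-! The three participants are `0` (Alice), `1` (Bob) and `2` (Charlie), elements of `Fin 3`.
Inputs and outputs are bits.  A correlation `P` assigns to every input triple `x` and every
output triple `y` the probability `P x y` of the outputs `y` given the inputs `x`. -/

/-- Conditional probabilities of three output bits given three input bits. -/
abbrev TriCorrelation : Type := (Fin 3 → Bool) → (Fin 3 → Bool) → ℝ

namespace MerminGHZ

/-- The promise on the inputs: their sum is even. -/
def Promise (x : Fin 3 → Bool) : Prop :=
  (∑ i, (x i).toNat) % 2 = 0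

/-- The winning condition: the exclusive or of the outputs is half the sum of the inputs. -/
def WinRel (x y : Fin 3 → Bool) : Prop :=
  (((y 0).xor (y 1)).xor (y 2)).toNat = (∑ i, (x i).toNat) / 2

open Classical in
/-- On every admissible input the winning outputs have total probability one. -/
def Wins (P : TriCorrelation) : Prop :=
  ∀ x, Promise x → ∑ y : Fin 3 → Bool, (if WinRel x y then P x y else 0) = 1

end MerminGHZ

/-- A strategy without communication for three participants, each of whom holds a quantum register
with computational basis indexed by `reg`.  The participants have access to common (and hence also
to private) classical randomness `ω : Ω`.  Given the input `x` and `ω`, participant `i` performs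
the measurement (POVM) `meas i x ω` on their register and outputs the outcome. -/
structure QuantumStrategy (Ω : Type*) [MeasurableSpace Ω] (reg : Type*)
    [Fintype reg] [DecidableEq reg] where
  meas : Fin 3 → Bool → Ω → Bool → Matrix reg reg ℂ
  posSemidef : ∀ i x ω y, (meas i x ω y).PosSemidef
  sum_eq_one : ∀ i x ω, ∑ y, meas i x ω y = 1
  measurable : ∀ i x y s t, Measurable fun ω => meas i x ω y s t

/-- The Born rule: `⟨ψ, (E 0 ⊗ E 1 ⊗ E 2) ψ⟩` for a vector `ψ` given by its amplitudes in the
product basis of the three registers. -/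
def bornProb {reg : Type*} [Fintype reg] [DecidableEq reg]
    (ψ : (Fin 3 → reg) → ℂ) (E : Fin 3 → Matrix reg reg ℂ) : ℝ :=
  (∑ s : Fin 3 → reg, ∑ t : Fin 3 → reg,
    (starRingEnd ℂ) (ψ s) * (∏ i, E i (s i) (t i)) * ψ t).re

/-- The correlation of a quantum strategy, for the shared state `ψ` and the law `μ` of the
classical randomness. -/
def QuantumStrategy.correlation {Ω : Type*} [MeasurableSpace Ω] {reg : Type*}
    [Fintype reg] [DecidableEq reg] (S : QuantumStrategy Ω reg)
    (μ : Measure Ω) (ψ : (Fin 3 → reg) → ℂ) : TriCorrelation :=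
  fun x y => ∫ ω, bornProb ψ (fun i => S.meas i (x i) ω (y i)) ∂μ

/-- Amplitudes of the two-qubit state `α|00⟩ + β|11⟩`. -/
def qubitPair (α β : ℂ) (a b : Fin 2) : ℂ :=
  if a = b then (if a = 0 then α else β) else 0

/-- Participants `i` and `j` hold the two halves of `α|00⟩ + β|11⟩`; the remaining participant
has a qubit in the state `|0⟩`, uncorrelated with everything else. -/
def onePairState (i j : Fin 3) (α β : ℂ) (s : Fin 3 → Fin 2) : ℂ :=
  qubitPair α β (s i) (s j) * (if ∀ k, k ≠ i → k ≠ j → s k = 0 then 1 else 0)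

/-- Each two of the three participants share a qubit pair.  Participant `k` holds two qubits: the
first one is half of the pair `α k |00⟩ + β k |11⟩` shared with participant `k + 1` (mod 3), the
second one is half of the pair shared with participant `k - 1` (mod 3). -/
def allPairsState (α β : Fin 3 → ℂ) (s : Fin 3 → Fin 2 × Fin 2) : ℂ :=
  ∏ k : Fin 3, qubitPair (α k) (β k) (s k).1 (s (k + 1)).2

/-- The state `(|000⟩ + |111⟩) / √2`. -/
def ghzState (s : Fin 3 → Fin 2) : ℂ :=
  if s 0 = s 1 ∧ s 1 = s 2 then ((Real.sqrt 2 : ℝ) : ℂ)⁻¹ else 0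

namespace MerminGHZ

/-- The Pauli matrix `X` on input `0`, the Pauli matrix `Y` on input `1`. -/
def pauli (x : Bool) : Matrix (Fin 2) (Fin 2) ℂ :=
  if x then !![0, -Complex.I; Complex.I, 0] else !![0, 1; 1, 0]

/-- The projection onto the eigenspace of `pauli x` for the eigenvalue `(-1) ^ y`. -/
def pauliProj (x y : Bool) : Matrix (Fin 2) (Fin 2) ℂ :=
  (1 / 2 : ℂ) • (1 + (if y then (-1 : ℂ) else 1) • pauli x)

theorem pauliProj_eq (x y : Bool) :
    pauliProj x y = (pauliProj x y).conjTranspose * pauliProj x y := by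
  have h : (starRingEnd ℂ) 2 = 2 := Complex.conj_ofNat 2
  ext i j
  fin_cases i <;> fin_cases j <;> cases x <;> cases y <;>
    simp [pauliProj, pauli, Matrix.mul_apply, Fin.sum_univ_two, h] <;>
    ring_nf <;> norm_num

theorem pauliProj_posSemidef (x y : Bool) : (pauliProj x y).PosSemidef := by
  rw [pauliProj_eq]
  exact Matrix.posSemidef_conjTranspose_mul_self _

theorem pauliProj_sum (x : Bool) : ∑ y, pauliProj x y = 1 := by
  ext i j
  fin_cases i <;> fin_cases j <;> cases x <;>
    simp [pauliProj, pauli] <;> norm_num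

/-- The quantum winning strategy: each participant measures their qubit of the GHZ state
with `X` on input `0` and with `Y` on input `1`.  No classical randomness is used. -/
def ghzStrategy : QuantumStrategy Unit (Fin 2) where
  meas _ x _ y := pauliProj x y
  posSemidef _ x _ y := pauliProj_posSemidef x y
  sum_eq_one _ x _ := pauliProj_sum x
  measurable _ _ _ _ _ := measurable_const

/-- The Mermin--GHZ correlations: those of the quantum winning strategy on the GHZ state. -/
def correlation : TriCorrelation :=
  ghzStrategy.correlation (Measure.dirac ()) ghzState

/-- `P` simulates the Mermin--GHZ correlations: it wins the game with probability one, and on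
every admissible input its probabilities are those of the quantum winning strategy. -/
def Simulates (P : TriCorrelation) : Prop :=
  Wins P ∧ ∀ x, Promise x → ∀ y, P x y = correlation x y

end MerminGHZ

/-- The non-local box: on inputs `a`, `b` the probability of the outputs `z`, `w`.  The solutions
of `z ⊕ w = a ∧ b` are equally likely (there are two of them), nothing else occurs. -/
def nonLocalBox (a b z w : Bool) : ℝ :=
  if z.xor w = (a && b) then 1 / 2 else 0

/-- A classical protocol for three participants without communication, with shared randomness
`ω : Ω`, in which Alice and Bob use a single non-local box once.  Each of them computes
the input to their end of the box from their input and `ω`, and the output also from the bit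
received from the box. -/
structure OneBoxProtocol (Ω : Type*) [MeasurableSpace Ω] where
  boxInA : Bool → Ω → Bool
  boxInB : Bool → Ω → Bool
  outA : Bool → Ω → Bool → Bool
  outB : Bool → Ω → Bool → Bool
  outC : Bool → Ω → Bool
  measurable_boxInA : ∀ x, Measurable (boxInA x)
  measurable_boxInB : ∀ x, Measurable (boxInB x)
  measurable_outA : ∀ x z, Measurable fun ω => outA x ω z
  measurable_outB : ∀ x w, Measurable fun ω => outB x ω w
  measurable_outC : ∀ x, Measurable (outC x)

/-- The correlation of a protocol with one non-local box, for the law `μ` of the randomness. -/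
def OneBoxProtocol.correlation {Ω : Type*} [MeasurableSpace Ω] (S : OneBoxProtocol Ω)
    (μ : Measure Ω) : TriCorrelation :=
  fun x y => ∫ ω, ∑ z : Bool, ∑ w : Bool,
    nonLocalBox (S.boxInA (x 0) ω) (S.boxInB (x 1) ω) z w *
      (if S.outA (x 0) ω z = y 0 ∧ S.outB (x 1) ω w = y 1 ∧ S.outC (x 2) ω = y 2
        then 1 else 0) ∂μ

end

open Matrix

/-! The two positive parts are finite checks: on an even input both correlations give each of the
four winning outputs weight 1/4 (`correlation_eq`, `boxProtocol_correlation`). For the negative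
parts, fix a value of the randomness at which no losing outcome occurs. Losing effects then
annihilate the state ψ, so the observables A_x, B_x, C_x (effect of outcome 0 minus effect of
outcome 1) square to the identity on ψ, and their products over an admissible input act on ψ as the
sign the game prescribes; no projectivity is needed. Hence A₀A₁ψ = B₀B₁ψ = C₀C₁ψ =: u, while A₁A₀ψ =
-u. Self-adjointness gives ⟨ψ, u⟩ = 0, and u ≠ 0 (`exists_common_coin`): each participant alone can
turn ψ into the same orthogonal vector. Bipartite sources forbid this. An operation of one
participant leaves untouched any source that participant has no part in. As every source is missed
by someone, u keeps all the factors of ψ (`triangleState_proportional`), so it is proportional to ψ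
and therefore zero. With one pair only, the isolated participant can merely rescale ψ. -/

theorem sum_fin_three {R M : Type*} [Fintype R] [AddCommMonoid M] (F : (Fin 3 → R) → M) :
    ∑ s, F s = ∑ a, ∑ b, ∑ c, F ![a, b, c] := by
  rw [← (Fin.consEquiv fun _ => R).sum_comp, Fintype.sum_prod_type]
  refine Finset.sum_congr rfl fun a _ => ?_
  rw [← (Fin.consEquiv fun _ => R).sum_comp, Fintype.sum_prod_type]
  refine Finset.sum_congr rfl fun b _ => ?_
  rw [← (Fin.consEquiv fun _ => R).sum_comp, Fintype.sum_prod_type]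
  refine Finset.sum_congr rfl fun c _ => ?_
  rw [Fintype.sum_unique]
  rfl

/-! ### Tensor products of local operators -/

/-- The matrix of `E 0 ⊗ E 1 ⊗ E 2` in the product basis. -/
def tensorMatrix {reg : Type*} (E : Fin 3 → Matrix reg reg ℂ) :
    Matrix (Fin 3 → reg) (Fin 3 → reg) ℂ :=
  fun s t => ∏ i, E i (s i) (t i)

/-- The operator `M` acting on the register of participant `i`. -/
def localOp {reg : Type*} [DecidableEq reg] (i : Fin 3) (M : Matrix reg reg ℂ) :
    Matrix (Fin 3 → reg) (Fin 3 → reg) ℂ :=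
  tensorMatrix (Pi.mulSingle i M)

section Tensor

variable {reg : Type*}

theorem tensorMatrix_mul [Fintype reg] (E F : Fin 3 → Matrix reg reg ℂ) :
    tensorMatrix E * tensorMatrix F = tensorMatrix (E * F) := by
  ext s u
  simp only [tensorMatrix, Matrix.mul_apply, Pi.mul_apply, ← Finset.prod_mul_distrib]
  rw [Finset.prod_univ_sum, Fintype.piFinset_univ]

theorem tensorMatrix_one [DecidableEq reg] : tensorMatrix (1 : Fin 3 → Matrix reg reg ℂ) = 1 := by
  ext s t
  simp only [tensorMatrix, Pi.one_apply, Matrix.one_apply, Finset.prod_ite_zero,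
    Finset.prod_const_one, Finset.mem_univ, true_implies, funext_iff]

theorem tensorMatrix_conjTranspose (E : Fin 3 → Matrix reg reg ℂ) :
    (tensorMatrix E)ᴴ = tensorMatrix fun i => (E i)ᴴ := by
  ext s t
  simp [tensorMatrix, Matrix.conjTranspose_apply]

/-- Factoring each E_i as B_iᴴ B_i exhibits the tensor product as BᴴB with B the tensor product of
the B_i. -/
theorem tensorMatrix_posSemidef [Fintype reg] [DecidableEq reg]
    {E : Fin 3 → Matrix reg reg ℂ} (hE : ∀ i, (E i).PosSemidef) :
    (tensorMatrix E).PosSemidef := by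
  have h : ∀ i, ∃ B : Matrix reg reg ℂ, E i = Bᴴ * B := fun i => by
    open scoped MatrixOrder in
    exact CStarAlgebra.nonneg_iff_eq_star_mul_self.mp (hE i).nonneg
  choose B hB using h
  have : tensorMatrix E = (tensorMatrix B)ᴴ * tensorMatrix B := by
    rw [tensorMatrix_conjTranspose, tensorMatrix_mul]
    exact congrArg _ (funext hB)
  rw [this]
  exact Matrix.posSemidef_conjTranspose_mul_self _

theorem localOp_mul [Fintype reg] [DecidableEq reg] (i : Fin 3) (M N : Matrix reg reg ℂ) :
    localOp i M * localOp i N = localOp i (M * N) := by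
  rw [localOp, localOp, tensorMatrix_mul, ← Pi.mulSingle_mul, localOp]

theorem localOp_commute [Fintype reg] [DecidableEq reg]
    {i j : Fin 3} (hij : i ≠ j) (M N : Matrix reg reg ℂ) :
    Commute (localOp i M) (localOp j N) := by
  rw [Commute, SemiconjBy, localOp, localOp, tensorMatrix_mul, tensorMatrix_mul]
  exact congrArg _ (Pi.mulSingle_commute (f := fun _ : Fin 3 => Matrix reg reg ℂ) hij M N).eq

theorem localOp_mul_mul [Fintype reg] [DecidableEq reg] (E : Fin 3 → Matrix reg reg ℂ) :
    localOp 0 (E 0) * localOp 1 (E 1) * localOp 2 (E 2) = tensorMatrix E := by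
  rw [localOp, localOp, localOp, tensorMatrix_mul, tensorMatrix_mul]
  congr 1
  funext i
  fin_cases i <;> simp

theorem localOp_one [DecidableEq reg] (i : Fin 3) : localOp i (1 : Matrix reg reg ℂ) = 1 := by
  rw [localOp, Pi.mulSingle_one, tensorMatrix_one]

theorem localOp_apply [DecidableEq reg] (i : Fin 3) (M : Matrix reg reg ℂ) (s t : Fin 3 → reg) :
    localOp i M s t = M (s i) (t i) * if ∀ k, k ≠ i → s k = t k then 1 else 0 := by
  fin_cases i <;>
    simp [localOp, tensorMatrix, Fin.prod_univ_three, Pi.mulSingle_apply, Fin.forall_fin_succ,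
      Matrix.one_apply] <;> split_ifs <;> simp_all

theorem localOp_add [DecidableEq reg] (i : Fin 3) (M N : Matrix reg reg ℂ) :
    localOp i (M + N) = localOp i M + localOp i N := by
  ext s t
  simp only [localOp_apply, Matrix.add_apply, add_mul]

theorem localOp_sub [DecidableEq reg] (i : Fin 3) (M N : Matrix reg reg ℂ) :
    localOp i (M - N) = localOp i M - localOp i N := by
  ext s t
  simp only [localOp_apply, Matrix.sub_apply, sub_mul]

theorem localOp_conjTranspose [DecidableEq reg] (i : Fin 3) (M : Matrix reg reg ℂ) :
    (localOp i M)ᴴ = localOp i Mᴴ := by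
  ext s t
  simp only [Matrix.conjTranspose_apply, localOp_apply, star_mul']
  simp only [eq_comm]
  split_ifs <;> simp

theorem bornProb_eq [Fintype reg] [DecidableEq reg]
    (ψ : (Fin 3 → reg) → ℂ) (E : Fin 3 → Matrix reg reg ℂ) :
    bornProb ψ E = (star ψ ⬝ᵥ (tensorMatrix E *ᵥ ψ)).re := by
  simp only [bornProb, dotProduct, Matrix.mulVec, Finset.mul_sum, tensorMatrix, Pi.star_apply,
    mul_assoc]
  rfl

theorem bornProb_nonneg [Fintype reg] [DecidableEq reg]
    (ψ : (Fin 3 → reg) → ℂ) {E : Fin 3 → Matrix reg reg ℂ}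
    (hE : ∀ i, (E i).PosSemidef) : 0 ≤ bornProb ψ E := by
  rw [bornProb_eq]
  exact (Complex.le_def.mp ((tensorMatrix_posSemidef hE).dotProduct_mulVec_nonneg ψ)).1

/-- An outcome of probability zero annihilates the state. -/
theorem tensorMatrix_mulVec_eq_zero [Fintype reg] [DecidableEq reg]
    {ψ : (Fin 3 → reg) → ℂ} {E : Fin 3 → Matrix reg reg ℂ}
    (hE : ∀ i, (E i).PosSemidef) (h : bornProb ψ E = 0) : tensorMatrix E *ᵥ ψ = 0 := by
  have hp := tensorMatrix_posSemidef hE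
  rw [← hp.dotProduct_mulVec_zero_iff]
  have h0 := Complex.le_def.mp (hp.dotProduct_mulVec_nonneg ψ)
  rw [bornProb_eq] at h
  exact Complex.ext h h0.2.symm

theorem sum_tensorMatrix [Fintype reg] [DecidableEq reg]
    {E : Fin 3 → Bool → Matrix reg reg ℂ} (hE : ∀ i, ∑ y, E i y = 1) :
    ∑ y : Fin 3 → Bool, tensorMatrix (fun i => E i (y i)) = 1 := by
  rw [← tensorMatrix_one]
  ext s t
  have h : ∀ i, (1 : Matrix reg reg ℂ) (s i) (t i) = ∑ y, E i y (s i) (t i) := fun i => by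
    rw [← hE i, Matrix.sum_apply]
  simp only [Matrix.sum_apply, tensorMatrix, Pi.one_apply, h]
  rw [Finset.prod_univ_sum, Fintype.piFinset_univ]

theorem sum_bornProb [Fintype reg] [DecidableEq reg]
    (ψ : (Fin 3 → reg) → ℂ) {E : Fin 3 → Bool → Matrix reg reg ℂ}
    (hE : ∀ i, ∑ y, E i y = 1) :
    ∑ y : Fin 3 → Bool, bornProb ψ (fun i => E i (y i)) = (star ψ ⬝ᵥ ψ).re := by
  simp only [bornProb_eq, ← Complex.re_sum]
  rw [← dotProduct_sum, ← Matrix.sum_mulVec, sum_tensorMatrix hE, Matrix.one_mulVec]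

end Tensor

/-! ### The quantum strategy and the protocol with a non-local box -/

namespace MerminGHZ

/-- Only constant index triples carry amplitude, so the double sum collapses to four terms. -/
theorem bornProb_ghzState (E : Fin 3 → Matrix (Fin 2) (Fin 2) ℂ) :
    bornProb ghzState E = (∑ a, ∑ b, ∏ i, E i a b).re / 2 := by
  have h2 : ((Real.sqrt 2 : ℝ) : ℂ)⁻¹ * ((Real.sqrt 2 : ℝ) : ℂ)⁻¹ = 1 / 2 := by
    rw [← mul_inv, ← Complex.ofReal_mul, Real.mul_self_sqrt (by norm_num)]
    norm_num
  have h3 : ∀ z : ℂ, ((Real.sqrt 2 : ℝ) : ℂ)⁻¹ * z * ((Real.sqrt 2 : ℝ) : ℂ)⁻¹ = z / 2 :=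
    fun z => by rw [mul_right_comm, h2]; ring
  simp only [bornProb, sum_fin_three, Fin.sum_univ_two, ghzState]
  simp [Fin.prod_univ_three, h3]
  ring

theorem correlation_eq {x : Fin 3 → Bool} (hx : Promise x) (y : Fin 3 → Bool)
    [Decidable (WinRel x y)] :
    correlation x y = if WinRel x y then 1 / 4 else 0 := by
  simp only [correlation, QuantumStrategy.correlation, integral_dirac, ghzStrategy,
    bornProb_ghzState, Fin.sum_univ_two, Fin.prod_univ_three, pauliProj, pauli]
  unfold Promise at hx
  simp only [WinRel, Fin.sum_univ_three] at hx ⊢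
  generalize x 0 = a at *
  generalize x 1 = b at *
  generalize x 2 = c at *
  generalize y 0 = a' at *
  generalize y 1 = b' at *
  generalize y 2 = c' at *
  cases a <;> cases b <;> cases c <;> simp at hx <;>
    cases a' <;> cases b' <;> cases c' <;> simp <;> norm_num

theorem wins_of_eq {P : TriCorrelation} (h : ∀ x, Promise x → ∀ y, P x y = correlation x y) :
    Wins P := by
  classical
  intro x hx
  simp only [h x hx, correlation_eq hx]
  unfold Promise at hx
  simp only [WinRel, Fin.sum_univ_three, sum_fin_three, Fintype.sum_bool] at hx ⊢
  generalize x 0 = a at *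
  generalize x 1 = b at *
  generalize x 2 = c at *
  cases a <;> cases b <;> cases c <;> simp at hx <;> simp <;> norm_num

/-- The protocol with one non-local box: Alice and Bob feed their inputs to the box and Alice outputs
what she receives; Bob and Charlie mask the box output and the input with a shared coin. -/
def boxProtocol : OneBoxProtocol Bool where
  boxInA x _ := x
  boxInB x _ := x
  outA _ _ z := z
  outB _ r w := w.xor r
  outC x r := x.xor r
  measurable_boxInA _ := .of_discrete
  measurable_boxInB _ := .of_discrete
  measurable_outA _ _ := .of_discrete
  measurable_outB _ _ := .of_discrete
  measurable_outC _ := .of_discrete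

/-- The coin cancels in the total parity, leaving (a ∧ b) ⊕ c. The promise forces c = a ⊕ b, so this
is a ∨ b, half the sum of the inputs. The coin and the box randomness together spread the outputs
evenly over the four winning triples. -/
theorem boxProtocol_correlation {x : Fin 3 → Bool} (hx : Promise x) (y : Fin 3 → Bool) :
    boxProtocol.correlation (PMF.uniformOfFintype Bool).toMeasure x y = correlation x y := by
  classical
  rw [correlation_eq hx, OneBoxProtocol.correlation, PMF.integral_eq_sum]
  unfold Promise at hx
  simp only [WinRel, Fin.sum_univ_three, boxProtocol, nonLocalBox, Fintype.sum_bool] at hx ⊢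
  generalize x 0 = a at *
  generalize x 1 = b at *
  generalize x 2 = c at *
  generalize y 0 = a' at *
  generalize y 1 = b' at *
  generalize y 2 = c' at *
  cases a <;> cases b <;> cases c <;> simp at hx <;>
    cases a' <;> cases b' <;> cases c' <;> simp <;> norm_num

end MerminGHZ

/-! ### Perfect strategies -/

section Algebra

variable {n : Type*} [Fintype n]

theorem Commute.mulVec_comm {M N : Matrix n n ℂ} (h : Commute M N) (v : n → ℂ) :
    M *ᵥ (N *ᵥ v) = N *ᵥ (M *ᵥ v) := by
  rw [Matrix.mulVec_mulVec, Matrix.mulVec_mulVec, h.eq]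

/-- If the losing outcomes of three commuting binary measurements annihilate `v`, then the product
of the observables acts on `v` as a sign. -/
theorem observable_mul_mulVec [DecidableEq n] {P Q R : Bool → Matrix n n ℂ} (hP : ∑ y, P y = 1)
    (hQ : ∑ y, Q y = 1) (hR : ∑ y, R y = 1) {v : n → ℂ} {w : Bool}
    (h : ∀ a b c, (a.xor b).xor c ≠ w → P a *ᵥ (Q b *ᵥ (R c *ᵥ v)) = 0) :
    (P false - P true) *ᵥ ((Q false - Q true) *ᵥ ((R false - R true) *ᵥ v)) =
      if w then -v else v := by
  have hv : v = (P true + P false) *ᵥ ((Q true + Q false) *ᵥ ((R true + R false) *ᵥ v)) := by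
    simp only [Fintype.sum_bool] at hP hQ hR
    simp only [hP, hQ, hR, Matrix.one_mulVec]
  conv_rhs => rw [hv]
  simp only [Matrix.add_mulVec, Matrix.sub_mulVec, Matrix.mulVec_add, Matrix.mulVec_sub]
  cases w <;> simp [-Matrix.mulVec_mulVec, h] <;> abel

/-- Under the same hypothesis each observable squares to the identity on `v`. -/
theorem observable_mulVec_observable_mulVec [DecidableEq n] {P Q R : Bool → Matrix n n ℂ}
    (hP : ∑ y, P y = 1) (hQ : ∑ y, Q y = 1) (hR : ∑ y, R y = 1) {v : n → ℂ} {w : Bool}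
    (h : ∀ a b c, (a.xor b).xor c ≠ w → P a *ᵥ (Q b *ᵥ (R c *ᵥ v)) = 0) :
    (P false - P true) *ᵥ ((P false - P true) *ᵥ v) = v := by
  have hv : v = (Q true + Q false) *ᵥ ((R true + R false) *ᵥ v) := by
    simp only [Fintype.sum_bool] at hQ hR
    simp only [hQ, hR, Matrix.one_mulVec]
  rw [Fintype.sum_bool, ← eq_sub_iff_add_eq] at hP
  have hc : Commute (P false) (P true) := by
    rw [hP]
    exact (Commute.one_right _).sub_right (Commute.refl _)
  -- Expand v along the outcomes of `Q` and `R`: for each b, c one of the two outcomes of `P` loses,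
  -- and the effects commute. This orthogonality makes both effects idempotent on v although they
  -- need not be projections.
  have h0 : P false *ᵥ (P true *ᵥ v) = 0 := by
    have h1 : ∀ b c, P false *ᵥ (P true *ᵥ (Q b *ᵥ (R c *ᵥ v))) = 0 := fun b c => by
      by_cases hbc : ((true.xor b).xor c) = w
      · rw [hc.mulVec_comm, h false b c (by revert hbc; cases b <;> cases c <;> cases w <;> decide),
          Matrix.mulVec_zero]
      · rw [h true b c hbc, Matrix.mulVec_zero]
    rw [hv]
    simp only [Matrix.add_mulVec, Matrix.mulVec_add, h1, add_zero]
  have h0' := h0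
  rw [hc.mulVec_comm] at h0'
  have h2 : P false *ᵥ v + P true *ᵥ v = v := by
    rw [← Matrix.add_mulVec, hP, add_sub_cancel, Matrix.one_mulVec]
  have h3 : P false *ᵥ (P false *ᵥ v) = P false *ᵥ v := by
    conv_rhs => rw [← h2]
    rw [Matrix.mulVec_add, h0, add_zero]
  have h4 : P true *ᵥ (P true *ᵥ v) = P true *ᵥ v := by
    conv_rhs => rw [← h2]
    rw [Matrix.mulVec_add, h0', zero_add]
  simp only [Matrix.sub_mulVec, Matrix.mulVec_sub, h0, h0', h3, h4]
  simpa using h2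

/-- The squares of a and b are trivial on v only; commutation brings each repeated factor next to v
before it is cancelled. -/
theorem mulVec_eq_of_mul_mulVec {a b c : Matrix n n ℂ} (hab : Commute a b) (hac : Commute a c)
    (hbc : Commute b c) {v w : n → ℂ} (ha : a *ᵥ (a *ᵥ v) = v) (hb : b *ᵥ (b *ᵥ v) = v)
    (h : a *ᵥ (b *ᵥ (c *ᵥ v)) = w) : c *ᵥ v = a *ᵥ (b *ᵥ w) := by
  rw [← h, ← hab.mulVec_comm (b *ᵥ _), hbc.mulVec_comm v, hbc.mulVec_comm, hb,
    hac.mulVec_comm v, hac.mulVec_comm, ha]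

/-- Observables that win the Mermin--GHZ game perfectly: on the state, the products `A₀A₁`, `B₀B₁`
and `C₀C₁` agree, `A₀` and `A₁` anticommute, and `C₀C₁` is invertible. -/
theorem observable_products_eq {A B C : Bool → Matrix n n ℂ}
    (hAB : ∀ x y, Commute (A x) (B y)) (hAC : ∀ x y, Commute (A x) (C y))
    (hBC : ∀ x y, Commute (B x) (C y)) {v : n → ℂ}
    (hA : ∀ x, A x *ᵥ (A x *ᵥ v) = v) (hB : ∀ x, B x *ᵥ (B x *ᵥ v) = v)
    (hC : ∀ x, C x *ᵥ (C x *ᵥ v) = v)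
    (h : ∀ x y, A x *ᵥ (B y *ᵥ (C (x.xor y) *ᵥ v)) = if x || y then -v else v) :
    A false *ᵥ (A true *ᵥ v) = C false *ᵥ (C true *ᵥ v) ∧
      B false *ᵥ (B true *ᵥ v) = C false *ᵥ (C true *ᵥ v) ∧
      A true *ᵥ (A false *ᵥ v) = -(C false *ᵥ (C true *ᵥ v)) ∧
      C true *ᵥ (C false *ᵥ (C false *ᵥ (C true *ᵥ v))) = v := by
  have key : ∀ x y, C (x.xor y) *ᵥ v = A x *ᵥ (B y *ᵥ if x || y then -v else v) := fun x y =>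
    mulVec_eq_of_mul_mulVec (hAB x y) (hAC x _) (hBC y _) (hA x) (hB y) (h x y)
  have h00 := key false false
  have h01 := key false true
  have h10 := key true false
  have h11 := key true true
  simp only [Bool.xor_self, Bool.false_xor, Bool.xor_false, Bool.or_self, Bool.or_true,
    Bool.or_false, if_true, if_false, Bool.false_eq_true, Matrix.mulVec_neg] at h00 h01 h10 h11
  have cC : ∀ x y z u, C z *ᵥ (A x *ᵥ (B y *ᵥ u)) = A x *ᵥ (B y *ᵥ (C z *ᵥ u)) :=
    fun x y z u => by rw [← (hAC x z).mulVec_comm, ← (hBC y z).mulVec_comm]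
  -- C₀v equals A₀B₀v and -A₁B₁v, while C₁v equals -A₀B₁v and -A₁B₀v. Each product identity combines
  -- one expression for C₀ with one for C₁ so that the factors of one participant cancel.
  refine ⟨?_, ?_, ?_, ?_⟩
  · rw [h01, Matrix.mulVec_neg, cC, h11]
    simp only [Matrix.mulVec_neg, neg_neg]
    rw [← (hAB true true).mulVec_comm, hB]
  · rw [h10, Matrix.mulVec_neg, cC, h11]
    simp only [Matrix.mulVec_neg, neg_neg]
    rw [(hAB true true).mulVec_comm v, (hAB true false).mulVec_comm, (hAB true true).mulVec_comm, hA]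
  · rw [h10, Matrix.mulVec_neg, cC, h00, neg_neg,
      ← (hAB false false).mulVec_comm, hB]
  · have h2 : C false *ᵥ (C false *ᵥ (C true *ᵥ v)) = C true *ᵥ v := by
      rw [h01, Matrix.mulVec_neg, cC, Matrix.mulVec_neg, cC, hC]
    rw [h2, hC]

theorem Matrix.IsHermitian.star_mulVec_dotProduct {M : Matrix n n ℂ} (hM : M.IsHermitian)
    (v w : n → ℂ) : star (M *ᵥ v) ⬝ᵥ w = star v ⬝ᵥ (M *ᵥ w) := by
  rw [Matrix.star_mulVec, hM.eq, Matrix.dotProduct_mulVec]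

end Algebra

/-! ### From perfect play to a common coin -/

section Coin

variable {reg : Type*} [Fintype reg] [DecidableEq reg]

open MerminGHZ

/-- If a strategy wins with probability one, then for some value of the randomness no losing
outcome occurs. -/
theorem exists_bornProb_eq_zero {Ω : Type*} [MeasurableSpace Ω] (μ : Measure Ω)
    [IsProbabilityMeasure μ] (S : QuantumStrategy Ω reg) {ψ : (Fin 3 → reg) → ℂ}
    (hψ : star ψ ⬝ᵥ ψ = 1) (hw : Wins (S.correlation μ ψ)) :
    ∃ ω, ∀ x, Promise x → ∀ y, ¬ WinRel x y →
      bornProb ψ (fun i => S.meas i (x i) ω (y i)) = 0 := by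
  classical
  have h0 : ∀ (x y : Fin 3 → Bool) (ω : Ω), 0 ≤ bornProb ψ (fun i => S.meas i (x i) ω (y i)) :=
    fun x y ω =>
    bornProb_nonneg ψ fun i => S.posSemidef i _ ω _
  have h1 : ∀ (x : Fin 3 → Bool) (ω : Ω),
      ∑ y : Fin 3 → Bool, bornProb ψ (fun i => S.meas i (x i) ω (y i)) = 1 := fun x ω => by
    have := sum_bornProb ψ (E := fun i y => S.meas i (x i) ω y) fun i => S.sum_eq_one i _ ω
    rw [this, hψ, Complex.one_re]
  have hle : ∀ (x y : Fin 3 → Bool) (ω : Ω), bornProb ψ (fun i => S.meas i (x i) ω (y i)) ≤ 1 :=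
    fun x y ω => by
    rw [← h1 x ω]
    exact Finset.single_le_sum
      (f := fun y : Fin 3 → Bool => bornProb ψ (fun i => S.meas i (x i) ω (y i)))
      (fun y _ => h0 x y ω) (Finset.mem_univ y)
  have hint : ∀ x y : Fin 3 → Bool,
      Integrable (fun ω => bornProb ψ (fun i => S.meas i (x i) ω (y i))) μ := fun x y => by
    refine Integrable.of_bound (C := 1) ?_ (.of_forall fun ω => ?_)
    · have hm := S.measurable
      refine Measurable.aestronglyMeasurable (Complex.measurable_re.comp ?_)
      refine Finset.measurable_sum _ fun s _ => Finset.measurable_sum _ fun t _ => ?_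
      exact (measurable_const.mul (Finset.measurable_prod _ fun i _ => hm i _ _ _ _)).mul
        measurable_const
    · rw [Real.norm_of_nonneg (h0 x y ω)]
      exact hle x y ω
  have hae : ∀ x, Promise x → ∀ y, ¬ WinRel x y →
      ∀ᵐ ω ∂μ, bornProb ψ (fun i => S.meas i (x i) ω (y i)) = 0 := fun x hx y hy => by
    have hsum : ∑ y, S.correlation μ ψ x y = 1 := by
      simp only [QuantumStrategy.correlation]
      rw [← integral_finsetSum _ fun y _ => hint x y]
      simp [h1]
    have hlose : ∑ y, (if WinRel x y then 0 else S.correlation μ ψ x y) = 0 := by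
      have hsplit : ∑ y, (if WinRel x y then S.correlation μ ψ x y else 0) +
          ∑ y, (if WinRel x y then 0 else S.correlation μ ψ x y) = 1 := by
        rw [← Finset.sum_add_distrib, ← hsum]
        refine Finset.sum_congr rfl fun y _ => ?_
        split_ifs <;> simp
      have := hw x hx
      linarith
    rw [Finset.sum_eq_zero_iff_of_nonneg fun y _ => by
      split_ifs
      · exact le_rfl
      · exact integral_nonneg (h0 x y)] at hlose
    have hz := hlose y (Finset.mem_univ y)
    rw [if_neg hy] at hz
    exact (integral_eq_zero_iff_of_nonneg (h0 x y) (hint x y)).mp hz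
  -- There are finitely many pairs x, y, so a single null set serves them all.
  have hall : ∀ᵐ ω ∂μ, ∀ x, Promise x → ∀ y, ¬ WinRel x y →
      bornProb ψ (fun i => S.meas i (x i) ω (y i)) = 0 := by
    simpa only [ae_all_iff, Filter.eventually_imp_distrib_left] using hae
  exact hall.exists

/-- A strategy that wins with probability one yields local operators which act on the state in the
same way, as a nonzero operator of vanishing expectation. -/
theorem exists_common_coin {Ω : Type*} [MeasurableSpace Ω] (μ : Measure Ω)
    [IsProbabilityMeasure μ] (S : QuantumStrategy Ω reg) {ψ : (Fin 3 → reg) → ℂ}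
    (hψ : star ψ ⬝ᵥ ψ = 1) (hw : Wins (S.correlation μ ψ)) :
    ∃ (Z : Fin 3 → Matrix reg reg ℂ) (u : (Fin 3 → reg) → ℂ),
      (∀ i, localOp i (Z i) *ᵥ ψ = u) ∧ star ψ ⬝ᵥ u = 0 ∧ u ≠ 0 := by
  obtain ⟨ω, hω⟩ := exists_bornProb_eq_zero μ S hψ hw
  set P : Fin 3 → Bool → Bool → Matrix (Fin 3 → reg) (Fin 3 → reg) ℂ :=
    fun i x y => localOp i (S.meas i x ω y)
  have hP : ∀ i x, ∑ y, P i x y = 1 := fun i x => by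
    have := S.sum_eq_one i x ω
    rw [Fintype.sum_bool] at this
    rw [Fintype.sum_bool, ← localOp_add, this, localOp_one]
  have hcomm : ∀ {i j : Fin 3}, i ≠ j → ∀ x y x' y', Commute (P i x y) (P j x' y') :=
    fun hij _ _ _ _ => localOp_commute hij _ _
  -- Under the promise the third input is `x.xor x'`, and half the sum of the inputs is then `x ||
  -- x'`.
  have hlose : ∀ x x' a b c, (a.xor b).xor c ≠ (x || x') →
      P 0 x a *ᵥ (P 1 x' b *ᵥ (P 2 (x.xor x') c *ᵥ ψ)) = 0 := fun x x' a b c h => by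
    have hz := tensorMatrix_mulVec_eq_zero (fun i => S.posSemidef i _ ω _)
      (hω ![x, x', x.xor x']
        (by rw [Promise, Fin.sum_univ_three]; cases x <;> cases x' <;> rfl) ![a, b, c] (by
          rw [WinRel, Fin.sum_univ_three]
          revert h
          cases x <;> cases x' <;> cases a <;> cases b <;> cases c <;> decide))
    rw [← localOp_mul_mul] at hz
    rw [Matrix.mulVec_mulVec, Matrix.mulVec_mulVec]
    exact hz
  -- Cyclic rearrangements, since `observable_mulVec_observable_mulVec` treats only the first
  -- measurement.
  have hlose₁ : ∀ x x' a b c, (a.xor b).xor c ≠ (x || x') →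
      P 1 x' a *ᵥ (P 2 (x.xor x') b *ᵥ (P 0 x c *ᵥ ψ)) = 0 := fun x x' a b c h => by
    rw [(hcomm (i := 2) (j := 0) (by decide) _ _ _ _).mulVec_comm,
      (hcomm (i := 1) (j := 0) (by decide) _ _ _ _).mulVec_comm]
    exact hlose x x' c a b (by revert h; cases a <;> cases b <;> cases c <;> simp)
  have hlose₂ : ∀ x x' a b c, (a.xor b).xor c ≠ (x || x') →
      P 2 (x.xor x') a *ᵥ (P 0 x b *ᵥ (P 1 x' c *ᵥ ψ)) = 0 := fun x x' a b c h => by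
    rw [(hcomm (i := 2) (j := 0) (by decide) _ _ _ _).mulVec_comm,
      (hcomm (i := 2) (j := 1) (by decide) _ _ _ _).mulVec_comm]
    exact hlose x x' b c a (by revert h; cases a <;> cases b <;> cases c <;> simp)
  set D : Fin 3 → Bool → Matrix reg reg ℂ :=
    fun i x => S.meas i x ω false - S.meas i x ω true
  set O : Fin 3 → Bool → Matrix (Fin 3 → reg) (Fin 3 → reg) ℂ :=
    fun i x => localOp i (D i x) with hO
  have hOP : ∀ i x, O i x = P i x false - P i x true := fun i x => localOp_sub i _ _
  have hOc : ∀ {i j : Fin 3}, i ≠ j → ∀ x y, Commute (O i x) (O j y) :=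
    fun hij _ _ => localOp_commute hij _ _
  have hOh : ∀ i x, (O i x).IsHermitian := fun i x => by
    rw [Matrix.IsHermitian, hO, localOp_conjTranspose]
    exact congrArg _
      ((S.posSemidef i x ω false).isHermitian.sub (S.posSemidef i x ω true).isHermitian).eq
  have h0 : ∀ x, O 0 x *ᵥ (O 0 x *ᵥ ψ) = ψ := fun x => by
    rw [hOP]
    exact observable_mulVec_observable_mulVec (hP _ _) (hP _ _) (hP _ _) (hlose x false)
  have h1 : ∀ x, O 1 x *ᵥ (O 1 x *ᵥ ψ) = ψ := fun x => by
    rw [hOP]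
    exact observable_mulVec_observable_mulVec (hP _ _) (hP _ _) (hP _ _) (hlose₁ false x)
  have h2 : ∀ x, O 2 x *ᵥ (O 2 x *ᵥ ψ) = ψ := fun x => by
    rw [hOP]
    have := observable_mulVec_observable_mulVec (hP _ _) (hP _ _) (hP _ _) (hlose₂ false x)
    rwa [Bool.false_xor] at this
  have hprod : ∀ x y, O 0 x *ᵥ (O 1 y *ᵥ (O 2 (x.xor y) *ᵥ ψ)) = if x || y then -ψ else ψ :=
    fun x y => by
      simp only [hOP]
      exact observable_mul_mulVec (hP _ _) (hP _ _) (hP _ _) (hlose x y)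
  obtain ⟨e0, e1, e2, e3⟩ := observable_products_eq (hOc (by decide)) (hOc (by decide))
    (hOc (by decide)) h0 h1 h2 hprod
  refine ⟨fun i => D i false * D i true, O 2 false *ᵥ (O 2 true *ᵥ ψ), fun i => ?_, ?_, ?_⟩
  · rw [← localOp_mul, ← Matrix.mulVec_mulVec]
    fin_cases i
    · exact e0
    · exact e1
    · rfl
  · have hA : O 0 false *ᵥ ψ = O 1 false *ᵥ (O 2 false *ᵥ ψ) := by
      refine mulVec_eq_of_mul_mulVec (hOc (by decide) _ _) (hOc (by decide) _ _)
        (hOc (by decide) _ _) (h1 _) (h2 _) ?_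
      rw [(hOc (i := 2) (j := 0) (by decide) _ _).mulVec_comm,
        (hOc (i := 1) (j := 0) (by decide) _ _).mulVec_comm]
      exact hprod false false
    -- ⟨ψ, A₀A₁ψ⟩ = ⟨A₀ψ, A₁ψ⟩ = ⟨B₀C₀ψ, A₁ψ⟩ = ⟨ψ, A₁B₀C₀ψ⟩ = ⟨ψ, A₁A₀ψ⟩: replacing A₀ by B₀C₀ on ψ
    -- lets it move past A₁. The two ends are opposite, hence zero.
    have hneg : star ψ ⬝ᵥ (O 0 false *ᵥ (O 0 true *ᵥ ψ)) =
        star ψ ⬝ᵥ (O 0 true *ᵥ (O 0 false *ᵥ ψ)) := by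
      rw [← (hOh 0 false).star_mulVec_dotProduct, hA, (hOh 1 false).star_mulVec_dotProduct,
        (hOh 2 false).star_mulVec_dotProduct,
        (hOc (i := 1) (j := 0) (by decide) _ _).mulVec_comm,
        (hOc (i := 2) (j := 0) (by decide) _ _).mulVec_comm,
        (hOc (i := 2) (j := 1) (by decide) _ _).mulVec_comm]
    rw [e0, e2, dotProduct_neg] at hneg
    exact self_eq_neg.mp hneg
  · intro hu
    rw [hu, Matrix.mulVec_zero, Matrix.mulVec_zero] at e3
    rw [← e3] at hψ
    simp at hψ

theorem localOp_mulVec (i : Fin 3) (M : Matrix reg reg ℂ) (v : (Fin 3 → reg) → ℂ)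
    (s : Fin 3 → reg) :
    (localOp i M *ᵥ v) s = ∑ a, M (s i) a * v (Function.update s i a) := by
  have h : ∀ a, M (s i) a * v (Function.update s i a) =
      ∑ t, if Function.update s i a = t then M (s i) a * v t else 0 := fun a => by simp
  simp only [h]
  rw [Finset.sum_comm, Matrix.mulVec, dotProduct]
  refine Finset.sum_congr rfl fun t _ => ?_
  simp only [Function.update_eq_iff, ite_and, Finset.sum_ite_eq', Finset.mem_univ, if_true,
    localOp_apply]
  split_ifs <;> simp

/-- A vector proportional to `ψ` and orthogonal to it vanishes. -/
theorem eq_zero_of_proportional {n : Type*} [Fintype n] {ψ u : n → ℂ} (hψ : star ψ ⬝ᵥ ψ = 1)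
    (h : ∀ s t, u s * ψ t = u t * ψ s) (h0 : star ψ ⬝ᵥ u = 0) : u = 0 := by
  funext s
  calc u s = ∑ t, star (ψ t) * (u s * ψ t) := by
        conv_lhs => rw [← mul_one (u s), ← hψ, dotProduct, Finset.mul_sum]
        exact Finset.sum_congr rfl fun t _ => by rw [Pi.star_apply]; ring
    _ = (∑ t, star (ψ t) * u t) * ψ s := by
        rw [Finset.sum_mul]
        exact Finset.sum_congr rfl fun t _ => by rw [h s t]; ring
    _ = 0 := by
        have : ∑ t, star (ψ t) * u t = 0 := h0
        rw [this, zero_mul]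

/-- No strategy wins if one of the participants holds a register in a basis state. -/
theorem not_wins_of_product {Ω : Type*} [MeasurableSpace Ω] (μ : Measure Ω)
    [IsProbabilityMeasure μ] (S : QuantumStrategy Ω reg) {ψ : (Fin 3 → reg) → ℂ}
    (hψ : star ψ ⬝ᵥ ψ = 1) (k : Fin 3) (e : reg) (hk : ∀ s, s k ≠ e → ψ s = 0) :
    ¬ Wins (S.correlation μ ψ) := by
  intro hw
  obtain ⟨Z, u, hZ, h0, hu⟩ := exists_common_coin μ S hψ hw
  refine hu (eq_zero_of_proportional hψ (fun s t => ?_) h0)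
  have key : ∀ s, u s = Z k e e * ψ s := fun s => by
    by_cases hs : s k = e
    · rw [← hZ k, localOp_mulVec, Finset.sum_eq_single e, hs, ← hs, Function.update_eq_self]
      · intro a _ ha
        rw [hk _ (by simpa using ha), mul_zero]
      · simp
    -- Off the basis state, use another participant's operator: it preserves the coordinate k, so it
    -- only meets zero amplitudes.
    · have hne : k ≠ k + 1 := by fin_cases k <;> decide
      rw [hk s hs, mul_zero, ← hZ (k + 1), localOp_mulVec]
      refine Finset.sum_eq_zero fun a _ => ?_
      rw [hk _ (by rwa [Function.update_of_ne hne]), mul_zero]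
  rw [key, key]
  ring

end Coin

/-- A state of a triangle of bipartite sources, `φ k` being shared by the participants `k`
and `k + 1`. -/
def triangleState {κ : Type*} (φ : Fin 3 → κ → κ → ℂ) (s : Fin 3 → κ × κ) : ℂ :=
  ∏ k : Fin 3, φ k (s k).1 (s (k + 1)).2

/-- A vector obtained from a triangle state by operations of each single participant is
proportional to the state. -/
theorem triangleState_proportional {κ : Type*} [Fintype κ] [DecidableEq κ]
    (φ : Fin 3 → κ → κ → ℂ) {Z : Fin 3 → Matrix (κ × κ) (κ × κ) ℂ} {u : (Fin 3 → κ × κ) → ℂ}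
    (hZ : ∀ i, localOp i (Z i) *ᵥ triangleState φ = u) (s t : Fin 3 → κ × κ) :
    u s * triangleState φ t = u t * triangleState φ s := by
  have hval : ∀ x y z : κ × κ, triangleState φ ![x, y, z] =
      φ 0 x.1 y.2 * φ 1 y.1 z.2 * φ 2 z.1 x.2 := fun x y z => by
    rw [triangleState, Fin.prod_univ_three]
    rfl
  have upd0 : ∀ x y z a : κ × κ, Function.update ![x, y, z] 0 a = ![a, y, z] := fun x y z a => by
    ext i <;> fin_cases i <;> rfl
  have upd1 : ∀ x y z a : κ × κ, Function.update ![x, y, z] 1 a = ![x, a, z] := fun x y z a => by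
    ext i <;> fin_cases i <;> rfl
  have upd2 : ∀ x y z a : κ × κ, Function.update ![x, y, z] 2 a = ![x, y, a] := fun x y z a => by
    ext i <;> fin_cases i <;> rfl
  -- Participant 2 has no share in source 0, so writing u through `Z 2` lets the amplitude of `φ 0`
  -- factor out of the sum. The other two sources are treated alike.
  have swap0 : ∀ p p' q q' r r' P Q', u ![(p, p'), (q, q'), (r, r')] * φ 0 P Q' =
      u ![(P, p'), (q, Q'), (r, r')] * φ 0 p q' := fun p p' q q' r r' P Q' => by
    rw [← hZ 2, localOp_mulVec, localOp_mulVec, Finset.sum_mul, Finset.sum_mul]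
    refine Finset.sum_congr rfl fun a _ => ?_
    rw [upd2, upd2, hval, hval]
    simp only [Matrix.cons_val]
    ring
  have swap1 : ∀ p p' q q' r r' Q R', u ![(p, p'), (q, q'), (r, r')] * φ 1 Q R' =
      u ![(p, p'), (Q, q'), (r, R')] * φ 1 q r' := fun p p' q q' r r' Q R' => by
    rw [← hZ 0, localOp_mulVec, localOp_mulVec, Finset.sum_mul, Finset.sum_mul]
    refine Finset.sum_congr rfl fun a _ => ?_
    rw [upd0, upd0, hval, hval]
    simp only [Matrix.cons_val]
    ring
  have swap2 : ∀ p p' q q' r r' R P', u ![(p, p'), (q, q'), (r, r')] * φ 2 R P' =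
      u ![(p, P'), (q, q'), (R, r')] * φ 2 r p' := fun p p' q q' r r' R P' => by
    rw [← hZ 1, localOp_mulVec, localOp_mulVec, Finset.sum_mul, Finset.sum_mul]
    refine Finset.sum_congr rfl fun a _ => ?_
    rw [upd1, upd1, hval, hval]
    simp only [Matrix.cons_val]
    ring
  have hs : ∀ s : Fin 3 → κ × κ,
      s = ![((s 0).1, (s 0).2), ((s 1).1, (s 1).2), ((s 2).1, (s 2).2)] := fun s => by
    ext i <;> fin_cases i <;> rfl
  rw [hs s, hs t, hval, hval]
  -- The indices of s are exchanged for those of t one source at a time.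
  linear_combination
    φ 1 (t 1).1 (t 2).2 * φ 2 (t 2).1 (t 0).2 *
      swap0 (s 0).1 (s 0).2 (s 1).1 (s 1).2 (s 2).1 (s 2).2 (t 0).1 (t 1).2 +
    φ 0 (s 0).1 (s 1).2 * φ 2 (t 2).1 (t 0).2 *
      swap1 (t 0).1 (s 0).2 (s 1).1 (t 1).2 (s 2).1 (s 2).2 (t 1).1 (t 2).2 +
    φ 0 (s 0).1 (s 1).2 * φ 1 (s 1).1 (s 2).2 *
      swap2 (t 0).1 (s 0).2 (t 1).1 (t 1).2 (s 2).1 (t 2).2 (t 2).1 (t 0).2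

/-- No strategy wins on a state of a triangle of bipartite sources. -/
theorem not_wins_triangleState {κ : Type*} [Fintype κ] [DecidableEq κ] {Ω : Type*}
    [MeasurableSpace Ω] (μ : Measure Ω) [IsProbabilityMeasure μ]
    (S : QuantumStrategy Ω (κ × κ)) (φ : Fin 3 → κ → κ → ℂ)
    (hφ : star (triangleState φ) ⬝ᵥ triangleState φ = 1) :
    ¬ MerminGHZ.Wins (S.correlation μ (triangleState φ)) := by
  intro hw
  obtain ⟨Z, u, hZ, h0, hu⟩ := exists_common_coin μ S hφ hw
  exact hu (eq_zero_of_proportional hφ (triangleState_proportional φ hZ) h0)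

theorem star_onePairState_dotProduct {i j : Fin 3} (hij : i ≠ j) {α β : ℂ}
    (h : ‖α‖ ^ 2 + ‖β‖ ^ 2 = 1) :
    star (onePairState i j α β) ⬝ᵥ onePairState i j α β = 1 := by
  have h' : (starRingEnd ℂ) α * α + (starRingEnd ℂ) β * β = 1 := by
    rw [Complex.conj_mul', Complex.conj_mul']
    exact_mod_cast h
  rw [← h', dotProduct, sum_fin_three]
  fin_cases i <;> fin_cases j <;> first | exact absurd rfl hij | skip
  all_goals simp [onePairState, qubitPair, Fin.forall_fin_succ, Fin.sum_univ_two]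

theorem star_allPairsState_dotProduct {α β : Fin 3 → ℂ}
    (h : ∀ k, ‖α k‖ ^ 2 + ‖β k‖ ^ 2 = 1) :
    star (allPairsState α β) ⬝ᵥ allPairsState α β = 1 := by
  have h' : ∀ k, (starRingEnd ℂ) (α k) * α k + (starRingEnd ℂ) (β k) * β k = 1 := fun k => by
    rw [Complex.conj_mul', Complex.conj_mul']
    exact_mod_cast h k
  have h3 := congrArg₂ (· * ·) (congrArg₂ (· * ·) (h' 0) (h' 1)) (h' 2)
  simp only [mul_one] at h3
  rw [← h3, dotProduct, sum_fin_three]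
  simp [allPairsState, qubitPair, Fin.prod_univ_three, Fintype.sum_prod_type, Fin.sum_univ_two]
  ring

/-- The Mermin--GHZ correlations come from a quantum winning strategy and are simulated with a
single use of one non-local box, but with qubit pairs `α|00⟩ + β|11⟩` in place of the box no quantum
strategy, even with shared randomness, wins the game or simulates the correlations: neither if some
two participants share such a pair, nor if each two of them do. -/
theorem mainTheorem12 :
    MerminGHZ.Wins MerminGHZ.correlation ∧
    (∃ (Ω : Type) (_ : MeasurableSpace Ω) (μ : Measure Ω) (_ : IsProbabilityMeasure μ)
      (S : OneBoxProtocol Ω), MerminGHZ.Simulates (S.correlation μ)) ∧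
    (∀ (i j : Fin 3), i ≠ j → ∀ (α β : ℂ), ‖α‖ ^ 2 + ‖β‖ ^ 2 = 1 →
      ∀ (Ω : Type*) [MeasurableSpace Ω] (μ : Measure Ω) [IsProbabilityMeasure μ]
        (S : QuantumStrategy Ω (Fin 2)),
        ¬ MerminGHZ.Wins (S.correlation μ (onePairState i j α β)) ∧
        ¬ MerminGHZ.Simulates (S.correlation μ (onePairState i j α β))) ∧
    (∀ (α β : Fin 3 → ℂ), (∀ k, ‖α k‖ ^ 2 + ‖β k‖ ^ 2 = 1) →
      ∀ (Ω : Type*) [MeasurableSpace Ω] (μ : Measure Ω) [IsProbabilityMeasure μ]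
        (S : QuantumStrategy Ω (Fin 2 × Fin 2)),
        ¬ MerminGHZ.Wins (S.correlation μ (allPairsState α β)) ∧
        ¬ MerminGHZ.Simulates (S.correlation μ (allPairsState α β))) := by
  refine ⟨MerminGHZ.wins_of_eq fun _ _ _ => rfl,
    ⟨Bool, inferInstance, (PMF.uniformOfFintype Bool).toMeasure, inferInstance,
      MerminGHZ.boxProtocol,
      MerminGHZ.wins_of_eq fun _ hx y => MerminGHZ.boxProtocol_correlation hx y,
      fun _ hx y => MerminGHZ.boxProtocol_correlation hx y⟩, ?_, ?_⟩
  · intro i j hij α β h Ω _ μ _ S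
    obtain ⟨k, hki, hkj⟩ : ∃ k : Fin 3, k ≠ i ∧ k ≠ j := by
      revert i j
      decide
    have hw := not_wins_of_product μ S (star_onePairState_dotProduct hij h) k 0 fun s hs => by
      rw [onePairState, if_neg fun hall => hs (hall k hki hkj), mul_zero]
    exact ⟨hw, fun hS => hw hS.1⟩
  · intro α β h Ω _ μ _ S
    -- `allPairsState` is by definition the triangle state whose sources are the qubit pairs.
    have hw : ¬ MerminGHZ.Wins (S.correlation μ (allPairsState α β)) :=
      not_wins_triangleState μ S (fun k => qubitPair (α k) (β k))
        (star_allPairsState_dotProduct h)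
    exact ⟨hw, fun hS => hw hS.1⟩
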